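/- Let $c>0$ be a constant. For $n \ge c$ let $G(n,n,p)$ with $p=c/n$ be the random bipartite graph with $n$ bins on one side and $n$ balls on the other, in which each of the $n^2$ possible bin–ball edges is present with probability $p$, independently of all the others. The greedy algorithm processes the balls one after the other; when a ball arrives, its edges are revealed and it is matched to a uniformly random bin among its neighbouring bins that are still unmatched, if there is one, and it is dropped otherwise. Let $\mu_{\mathrm G}(n,n,c/n)$ be the number of balls matched by the greedy algorithm. Then, asymptotically almost surely, $$\frac{\mu_{\mathrm G}(n,n,c/n)}{n} = 1-\frac{\log(2-e^{-c})}{c}+o(1),$$ that is, there is a deterministic sequence $\varepsilon_n\to 0$ such that $$\mathbb P\left(\left|\frac{\mu_{\mathrm G}(n,n,c/n)}{n}-\left(1-\frac{\log(2-e^{-c})}{c}\right)\right|\le\varepsilon_n\right)\longrightarrow 1 \qquad (n\to\infty).$$ -/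

import Mathlib

open Filter Topology ProbabilityTheory

noncomputable section

/-- A bipartite graph with bins `Fin n` and balls `Fin n`, given by its edge set:
`(i, j) ∈ G` means that bin `i` and ball `j` are adjacent. -/
abbrev BipartiteGraph (n : ℕ) : Type := Set (Fin n × Fin n)

/-- The random bipartite graph `G(n,n,p)`: each of the `n * n` potential edges is present with
probability `p`, independently of all the others. -/
def randomBipartiteGraph (n : ℕ) (p : unitInterval) : PMF (BipartiteGraph n) :=
  (setBernoulli (Set.univ : Set (Fin n × Fin n)) p).toPMF

open scoped Classical in
/-- The set `U(j)` of the bins that are neighbours of ball `j` in the graph `G` and are not matched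
by the current matching `M` (a set of pairs `(bin, ball)`). -/
def availableBins {n : ℕ} (G : BipartiteGraph n) (M : Finset (Fin n × Fin n)) (j : Fin n) :
    Finset (Fin n) :=
  Finset.univ.filter fun i => (i, j) ∈ G ∧ ∀ j' : Fin n, (i, j') ∉ M

open scoped Classical in
/-- The arrival of ball `j`: it is matched to a uniformly random available neighbouring bin if there
is one, and dropped otherwise. -/
def greedyStep {n : ℕ} (G : BipartiteGraph n) (M : Finset (Fin n × Fin n)) (j : Fin n) :
    PMF (Finset (Fin n × Fin n)) :=
  if h : (availableBins G M j).Nonempty then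
    (PMF.uniformOfFinset (availableBins G M j) h).map fun i => insert (i, j) M
  else
    PMF.pure M

/-- The (random) matching that the greedy algorithm outputs on the graph `G`: the matching is
initially empty and the balls `0, 1, …, n - 1` arrive one after the other. -/
def greedyMatching {n : ℕ} (G : BipartiteGraph n) : PMF (Finset (Fin n × Fin n)) :=
  (List.finRange n).foldlM (greedyStep G) ∅

/-- The law of the size of the matching obtained by the greedy algorithm on `G(n,n,p)`; the random
choices of the algorithm are made on top of the randomness of the graph. -/
def greedyMatchingSize (n : ℕ) (p : unitInterval) : PMF ℕ :=
  ((randomBipartiteGraph n p).bind greedyMatching).map Finset.card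

end

/-! Put q = 1 - p and let u be the number of free bins. Since the edges of an arriving ball are
still fresh, u stays put with probability q^u and drops by one otherwise, whatever bin is chosen: u
is a Markov chain. Its transition operator has the eigenfunctions q^(-u) - 1 and (q^(-u) - 1)(q^(-u)
- q⁻¹), with eigenvalues q and q². Hence, starting from u = n, after n balls q^(-u) has mean exactly
2 - q^n and variance exactly (p/q)(1 - q^n)² (`finExpect_greedyLaw_sq`), which tends to 0.
Chebyshev's inequality then concentrates q^(-u). Taking logarithms and dividing by -n log q → c
gives u/n → log(2 - e^(-c))/c, and the matching has size n - u. -/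

noncomputable section

/-! ### Expectations of real functions on finite types -/

section Expectation

variable {α β : Type*} [Fintype α] [Fintype β]

/-- The expectation of a real function under a probability mass function on a finite type. -/
def finExpect (μ : PMF α) (φ : α → ℝ) : ℝ := ∑ x, (μ x).toReal * φ x

lemma PMF.sum_toReal (μ : PMF α) : ∑ x, (μ x).toReal = 1 := by
  rw [← ENNReal.toReal_sum fun x _ => μ.apply_ne_top x, ← tsum_fintype (L := .unconditional _),
    μ.tsum_coe, ENNReal.toReal_one]

lemma finExpect_const (μ : PMF α) (a : ℝ) : finExpect μ (fun _ => a) = a := by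
  rw [finExpect, ← Finset.sum_mul, μ.sum_toReal, one_mul]

lemma finExpect_pure (a : α) (φ : α → ℝ) : finExpect (PMF.pure a) φ = φ a := by
  classical
  simp [finExpect, PMF.pure_apply, apply_ite ENNReal.toReal]

lemma finExpect_bind (μ : PMF α) (f : α → PMF β) (φ : β → ℝ) :
    finExpect (μ.bind f) φ = finExpect μ fun x => finExpect (f x) φ := by
  simp only [finExpect, PMF.bind_apply, tsum_fintype]
  simp_rw [ENNReal.toReal_sum fun x _ => ENNReal.mul_ne_top (μ.apply_ne_top x)
    ((f x).apply_ne_top _), ENNReal.toReal_mul, Finset.sum_mul, Finset.mul_sum, mul_assoc]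
  rw [Finset.sum_comm]

lemma finExpect_map (μ : PMF α) (f : α → β) (φ : β → ℝ) :
    finExpect (μ.map f) φ = finExpect μ (φ ∘ f) := by
  rw [← PMF.bind_pure_comp, finExpect_bind]
  simp [finExpect_pure, Function.comp_def]

lemma finExpect_congr_support {μ : PMF α} {φ ψ : α → ℝ} (h : ∀ x ∈ μ.support, φ x = ψ x) :
    finExpect μ φ = finExpect μ ψ := by
  refine Finset.sum_congr rfl fun x _ => ?_
  by_cases hx : x ∈ μ.support
  · rw [h x hx]
  · rw [PMF.mem_support_iff, not_not] at hx
    simp [hx]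

lemma finExpect_add (μ : PMF α) (φ ψ : α → ℝ) :
    finExpect μ (fun x => φ x + ψ x) = finExpect μ φ + finExpect μ ψ := by
  simp [finExpect, mul_add, Finset.sum_add_distrib]

lemma finExpect_const_mul (μ : PMF α) (a : ℝ) (φ : α → ℝ) :
    finExpect μ (fun x => a * φ x) = a * finExpect μ φ := by
  simp only [finExpect, Finset.mul_sum, mul_left_comm]

lemma toMeasure_toReal_eq_finExpect [MeasurableSpace α] [MeasurableSingletonClass α] (μ : PMF α)
    (s : Set α) : (μ.toMeasure s).toReal = finExpect μ (s.indicator fun _ => 1) := by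
  rw [PMF.toMeasure_apply_fintype, ENNReal.toReal_sum]
  · refine Finset.sum_congr rfl fun x _ => ?_
    by_cases hx : x ∈ s <;> simp [hx]
  · intro x _
    by_cases hx : x ∈ s <;> simp [hx, μ.apply_ne_top]

/-- Chebyshev's inequality around an arbitrary centre. -/
lemma toMeasure_toReal_le_of_finExpect_sq [MeasurableSpace α] [MeasurableSingletonClass α]
    (μ : PMF α) (φ : α → ℝ) (a : ℝ) {δ : ℝ} (hδ : 0 < δ) :
    (μ.toMeasure {x | δ < |φ x - a|}).toReal ≤ finExpect μ (fun x => (φ x - a) ^ 2) / δ ^ 2 := by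
  rw [toMeasure_toReal_eq_finExpect, div_eq_inv_mul, ← finExpect_const_mul]
  refine Finset.sum_le_sum fun x _ => mul_le_mul_of_nonneg_left ?_ ENNReal.toReal_nonneg
  by_cases hx : δ < |φ x - a|
  · rw [Set.indicator_of_mem (by exact hx)]
    beta_reduce
    rw [← div_eq_inv_mul, one_le_div (by positivity), ← sq_abs (φ x - a)]
    gcongr
  · rw [Set.indicator_of_notMem (by exact hx)]
    positivity

end Expectation

/-! ### The random bipartite graph -/

section RandomGraph

variable {n : ℕ}

/-- The graph that agrees with `G'` on the edges in `J` and with `G` on all the others. -/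
def spliceGraph (J : Set (Fin n × Fin n)) (G G' : BipartiteGraph n) : BipartiteGraph n :=
  J.ite G' G

lemma mem_spliceGraph {J : Set (Fin n × Fin n)} {G G' : BipartiteGraph n} {e : Fin n × Fin n} :
    e ∈ spliceGraph J G G' ↔ (e ∈ J ∧ e ∈ G') ∨ (e ∉ J ∧ e ∈ G) := by
  simp [spliceGraph, Set.ite, and_comm]

open scoped Classical in
lemma randomBipartiteGraph_apply_toReal (p : unitInterval) (G : BipartiteGraph n) :
    (randomBipartiteGraph n p G).toReal = ∏ e, if e ∈ G then (p : ℝ) else 1 - p := by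
  have h : (randomBipartiteGraph n p G).toReal
      = (setBernoulli (Set.univ : Set (Fin n × Fin n)) p).real {G} := rfl
  rw [h, setBernoulli_real_singleton p (Set.subset_univ G) Set.finite_univ, Finset.prod_ite,
    Finset.prod_const, Finset.prod_const]
  congr 2
  · rw [Set.ncard_eq_toFinset_card']
    congr 1
    ext
    simp
  · rw [Set.ncard_eq_toFinset_card']
    congr 1
    ext
    simp

/-- Edge by edge, both sides have the same two factors, in swapped order on `J`. So exchanging the
`J`-parts of two independent copies preserves their joint law. -/
lemma randomBipartiteGraph_splice_mul (p : unitInterval) (J : Set (Fin n × Fin n))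
    (G G' : BipartiteGraph n) :
    (randomBipartiteGraph n p (spliceGraph J G G')).toReal
        * (randomBipartiteGraph n p (spliceGraph J G' G)).toReal
      = (randomBipartiteGraph n p G).toReal * (randomBipartiteGraph n p G').toReal := by
  classical
  simp only [randomBipartiteGraph_apply_toReal, ← Finset.prod_mul_distrib, mem_spliceGraph]
  refine Finset.prod_congr rfl fun e _ => ?_
  by_cases hJ : e ∈ J
  · simp [hJ, mul_comm]
  · simp [hJ]

/-- Disjoint sets of edges of the random bipartite graph are independent. -/
lemma finExpect_randomBipartiteGraph_mul (p : unitInterval) (J : Set (Fin n × Fin n))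
    (F H : BipartiteGraph n → ℝ) (hF : ∀ G G', F (spliceGraph J G G') = F G')
    (hH : ∀ G G', H (spliceGraph J G G') = H G) :
    finExpect (randomBipartiteGraph n p) (fun G => F G * H G)
      = finExpect (randomBipartiteGraph n p) F * finExpect (randomBipartiteGraph n p) H := by
  set μ := randomBipartiteGraph n p
  let e : BipartiteGraph n × BipartiteGraph n ≃ BipartiteGraph n × BipartiteGraph n :=
    Function.Involutive.toPerm (fun x => (spliceGraph J x.1 x.2, spliceGraph J x.2 x.1)) (by
      rintro ⟨G, G'⟩
      ext e <;> simp only [mem_spliceGraph] <;> tauto)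
  -- Introduce an independent second copy of the graph, then use the exchange `e` to move `F` onto
  -- it.
  calc finExpect μ (fun G => F G * H G)
      = ∑ x : BipartiteGraph n × BipartiteGraph n,
          (μ x.1).toReal * (μ x.2).toReal * (F x.1 * H x.1) := by
        rw [Fintype.sum_prod_type]
        refine Finset.sum_congr rfl fun G _ => ?_
        dsimp only
        rw [← Finset.sum_mul, ← Finset.mul_sum, μ.sum_toReal, mul_one]
    _ = ∑ x : BipartiteGraph n × BipartiteGraph n,
          (μ x.1).toReal * (μ x.2).toReal * (F x.2 * H x.1) := by
        rw [← Equiv.sum_comp e]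
        refine Finset.sum_congr rfl fun x _ => ?_
        change (μ (spliceGraph J x.1 x.2)).toReal * (μ (spliceGraph J x.2 x.1)).toReal
          * (F (spliceGraph J x.1 x.2) * H (spliceGraph J x.1 x.2)) = _
        rw [randomBipartiteGraph_splice_mul, hF, hH]
    _ = finExpect μ F * finExpect μ H := by
        rw [Fintype.sum_prod_type, mul_comm, finExpect, finExpect, Finset.sum_mul_sum]
        refine Finset.sum_congr rfl fun G _ => Finset.sum_congr rfl fun G' _ => ?_
        ring

open scoped Classical in
/-- The probability that none of the edges in a given set is present. -/
lemma randomBipartiteGraph_disjoint (p : unitInterval) (A : Finset (Fin n × Fin n)) :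
    finExpect (randomBipartiteGraph n p) (fun G => if ∀ e ∈ A, e ∉ G then 1 else 0)
      = (1 - p : ℝ) ^ A.card := by
  have key : ∀ G : BipartiteGraph n, (randomBipartiteGraph n p G).toReal *
      (if ∀ e ∈ A, e ∉ G then 1 else 0) =
      ∏ e, if e ∈ G then (if e ∈ A then 0 else (p : ℝ)) else 1 - p := by
    intro G
    rw [randomBipartiteGraph_apply_toReal]
    split_ifs with h
    · rw [mul_one]
      refine Finset.prod_congr rfl fun e _ => ?_
      by_cases he : e ∈ A
      · simp [h e he]
      · simp [he]
    · push Not at h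
      obtain ⟨e, he, heG⟩ := h
      rw [mul_zero, eq_comm]
      exact Finset.prod_eq_zero (Finset.mem_univ e) (by simp [he, heG])
  rw [finExpect, Finset.sum_congr rfl fun G _ => key G]
  -- The sum over all graphs is the expansion of a product whose factors are 0 + (1 - p) on `A` and
  -- p + (1 - p) = 1 elsewhere.
  have h2 := Finset.prod_add (fun e => if e ∈ A then 0 else (p : ℝ)) (fun _ => 1 - (p : ℝ))
    (Finset.univ : Finset (Fin n × Fin n))
  rw [Finset.powerset_univ] at h2
  have h3 : ∏ e : Fin n × Fin n, ((if e ∈ A then 0 else (p : ℝ)) + (1 - p))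
      = (1 - p : ℝ) ^ A.card := by
    simp_rw [ite_add, zero_add, add_sub_cancel]
    rw [Finset.prod_ite_mem, Finset.univ_inter, Finset.prod_const]
  rw [← h3, h2]
  refine Fintype.sum_equiv Fintype.finsetEquivSet.symm _ _ fun G => ?_
  rw [Finset.prod_ite]
  congr 1
  · refine Finset.prod_congr ?_ fun _ _ => rfl
    ext
    simp [Fintype.finsetEquivSet]
  · refine Finset.prod_congr ?_ fun _ _ => rfl
    ext
    simp [Fintype.finsetEquivSet]

end RandomGraph

/-! ### The greedy algorithm -/

section Greedy

variable {n : ℕ}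

open scoped Classical in
/-- The set of bins that are not matched by `M`. -/
def freeBins (M : Finset (Fin n × Fin n)) : Finset (Fin n) :=
  Finset.univ.filter fun i => ∀ j, (i, j) ∉ M

lemma greedyStep_congr {G G' : BipartiteGraph n} {j : Fin n}
    (h : ∀ i, (i, j) ∈ G ↔ (i, j) ∈ G') (M : Finset (Fin n × Fin n)) :
    greedyStep G M j = greedyStep G' M j := by
  have hA : availableBins G M j = availableBins G' M j := by
    ext i
    simp [availableBins, h]
  unfold greedyStep
  simp only [hA]

lemma foldlM_greedyStep_congr {G G' : BipartiteGraph n} {l : List (Fin n)}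
    (h : ∀ j ∈ l, ∀ i, (i, j) ∈ G ↔ (i, j) ∈ G') (M : Finset (Fin n × Fin n)) :
    l.foldlM (greedyStep G) M = l.foldlM (greedyStep G') M := by
  induction l generalizing M with
  | nil => rfl
  | cons j l ih =>
    rw [List.foldlM_cons, List.foldlM_cons, greedyStep_congr (h j List.mem_cons_self)]
    congr 1
    funext M'
    exact ih (fun j' hj' => h j' (List.mem_cons_of_mem _ hj')) M'

lemma card_freeBins_insert {G : BipartiteGraph n} {M : Finset (Fin n × Fin n)} {i j : Fin n}
    (hi : i ∈ availableBins G M j) :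
    (freeBins (insert (i, j) M)).card = (freeBins M).card - 1 ∧ 0 < (freeBins M).card ∧
      (insert (i, j) M).card = M.card + 1 := by
  classical
  simp only [availableBins, Finset.mem_filter, Finset.mem_univ, true_and] at hi
  have hi' : i ∈ freeBins M := by simpa [freeBins] using hi.2
  have h : freeBins (insert (i, j) M) = (freeBins M).erase i := by
    ext i'
    simp only [freeBins, Finset.mem_filter, Finset.mem_univ, true_and, Finset.mem_erase,
      Finset.mem_insert, Prod.mk.injEq, not_or, not_and, forall_and]
    exact and_congr_left fun _ => ⟨fun h e => h j e rfl, fun h j' e => absurd e h⟩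
  rw [h, Finset.card_erase_of_mem hi']
  exact ⟨rfl, Finset.card_pos.2 ⟨i, hi'⟩, Finset.card_insert_of_notMem (hi.2 j)⟩

lemma freeBins_add_card_of_mem_support {G : BipartiteGraph n} {M M' : Finset (Fin n × Fin n)}
    {j : Fin n} (hM' : M' ∈ (greedyStep G M j).support) :
    (freeBins M').card + M'.card = (freeBins M).card + M.card := by
  unfold greedyStep at hM'
  split_ifs at hM' with h
  · simp only [PMF.mem_support_map_iff, PMF.mem_support_uniformOfFinset_iff] at hM'
    obtain ⟨i, hi, rfl⟩ := hM'
    have := card_freeBins_insert hi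
    omega
  · rw [PMF.mem_support_pure_iff] at hM'
    rw [hM']

lemma freeBins_add_card_of_mem_support_foldlM {G : BipartiteGraph n} {l : List (Fin n)}
    {M M' : Finset (Fin n × Fin n)} (hM' : M' ∈ (l.foldlM (greedyStep G) M).support) :
    (freeBins M').card + M'.card = (freeBins M).card + M.card := by
  induction l generalizing M with
  | nil =>
    have : M' ∈ (PMF.pure M).support := hM'
    rw [PMF.mem_support_pure_iff] at this
    rw [this]
  | cons j l ih =>
    rw [List.foldlM_cons] at hM'
    obtain ⟨M₁, h₁, h₂⟩ := (PMF.mem_support_bind_iff _ _ _).1 hM'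
    rw [ih h₂, freeBins_add_card_of_mem_support h₁]

-- The choice among available bins does not affect how many remain. With no free bin the indicator
-- is vacuously 1, so the truncated `0 - 1` is harmless.
open scoped Classical in
lemma finExpect_greedyStep (G : BipartiteGraph n) (M : Finset (Fin n × Fin n)) (j : Fin n)
    (ψ : ℕ → ℝ) :
    finExpect (greedyStep G M j) (fun M' => ψ (freeBins M').card)
      = ψ ((freeBins M).card - 1) + (ψ (freeBins M).card - ψ ((freeBins M).card - 1)) *
          if ∀ e ∈ (freeBins M).image (·, j), e ∉ G then 1 else 0 := by
  have hiff : (∀ e ∈ (freeBins M).image (·, j), e ∉ G) ↔ ¬ (availableBins G M j).Nonempty := by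
    simp only [Finset.mem_image, forall_exists_index, and_imp, forall_apply_eq_imp_iff₂,
      Finset.not_nonempty_iff_eq_empty, Finset.eq_empty_iff_forall_notMem, availableBins, freeBins,
      Finset.mem_filter, Finset.mem_univ, true_and, not_and]
    exact forall_congr' fun i => ⟨fun h a b => h b a, fun h a b => h b a⟩
  unfold greedyStep
  by_cases h : (availableBins G M j).Nonempty
  · rw [dif_pos h, if_neg (by rwa [hiff, not_not]), finExpect_map, mul_zero, add_zero,
      ← finExpect_const (PMF.uniformOfFinset (availableBins G M j) h)
        (ψ ((freeBins M).card - 1))]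
    refine finExpect_congr_support fun i hi => ?_
    rw [PMF.mem_support_uniformOfFinset_iff] at hi
    rw [Function.comp_apply, (card_freeBins_insert hi).1]
  · rw [dif_neg h, if_pos (by rwa [hiff]), finExpect_pure]
    ring

/-- The arrival of one ball, averaged over the random graph. -/
lemma finExpect_bind_greedyStep (p : unitInterval) (M : Finset (Fin n × Fin n)) (j : Fin n)
    (ψ : ℕ → ℝ) :
    finExpect ((randomBipartiteGraph n p).bind fun G => greedyStep G M j)
        (fun M' => ψ (freeBins M').card)
      = (1 - p : ℝ) ^ (freeBins M).card * ψ (freeBins M).card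
        + (1 - (1 - p : ℝ) ^ (freeBins M).card) * ψ ((freeBins M).card - 1) := by
  classical
  simp_rw [finExpect_bind, finExpect_greedyStep]
  rw [finExpect_add, finExpect_const, finExpect_const_mul, randomBipartiteGraph_disjoint,
    Finset.card_image_of_injective _ fun a b h => (Prod.mk.inj h).1]
  ring

/-- An eigenfunction `ψ` of the one-step transition operator of the number of free bins evolves
geometrically under the greedy algorithm. -/
lemma finExpect_foldlM_greedyStep (p : unitInterval) (ψ : ℕ → ℝ) (r : ℝ)
    (hψ : ∀ u : ℕ, (1 - p : ℝ) ^ u * ψ u + (1 - (1 - p : ℝ) ^ u) * ψ (u - 1) = r * ψ u)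
    {l : List (Fin n)} (hl : l.Nodup) (M : Finset (Fin n × Fin n)) :
    finExpect ((randomBipartiteGraph n p).bind fun G => l.foldlM (greedyStep G) M)
        (fun M' => ψ (freeBins M').card)
      = r ^ l.length * ψ (freeBins M).card := by
  induction l generalizing M with
  | nil =>
    have : ((randomBipartiteGraph n p).bind fun G =>
        ([] : List (Fin n)).foldlM (greedyStep G) M) = PMF.pure M := PMF.bind_const _ _
    rw [this, finExpect_pure]
    simp
  | cons j l ih =>
    obtain ⟨hj, hl⟩ := List.nodup_cons.1 hl
    set φ : Finset (Fin n × Fin n) → ℝ := fun M' => ψ (freeBins M').card with hφ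
    set μ := randomBipartiteGraph n p with hμ
    -- Deferred decisions: the step for `j` reads only edges at `j`, and the later steps read none
    -- of them because `j ∉ l`.
    have hindep : ∀ M' : Finset (Fin n × Fin n),
        finExpect μ (fun G => (greedyStep G M j M').toReal
            * finExpect (l.foldlM (greedyStep G) M') φ)
          = finExpect μ (fun G => (greedyStep G M j M').toReal) * (r ^ l.length * φ M') := by
      intro M'
      rw [← ih hl M', finExpect_bind]
      refine finExpect_randomBipartiteGraph_mul p {e | e.2 = j} _ _ (fun G G' => ?_)
        fun G G' => ?_
      · rw [greedyStep_congr fun i => ?_]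
        simp [mem_spliceGraph]
      · rw [foldlM_greedyStep_congr fun j' hj' i => ?_]
        have : j' ≠ j := fun h => hj (h ▸ hj')
        simp [mem_spliceGraph, this]
    have hcons : ∀ G : BipartiteGraph n, finExpect ((j :: l).foldlM (greedyStep G) M) φ
        = ∑ M', (greedyStep G M j M').toReal * finExpect (l.foldlM (greedyStep G) M') φ :=
      fun G => by
        rw [List.foldlM_cons]
        exact finExpect_bind _ _ _
    have hswap : ∀ f : BipartiteGraph n → Finset (Fin n × Fin n) → ℝ,
        finExpect μ (fun G => ∑ M', f G M') = ∑ M', finExpect μ (fun G => f G M') := fun f => by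
      simp only [finExpect, Finset.mul_sum]
      exact Finset.sum_comm
    calc finExpect (μ.bind fun G => (j :: l).foldlM (greedyStep G) M) φ
        = ∑ M', finExpect μ (fun G => (greedyStep G M j M').toReal) * (r ^ l.length * φ M') := by
          rw [finExpect_bind]
          simp_rw [hcons]
          rw [hswap]
          exact Finset.sum_congr rfl fun M' _ => hindep M'
      _ = r ^ l.length * finExpect (μ.bind fun G => greedyStep G M j) φ := by
          rw [finExpect_bind]
          conv_rhs => rw [finExpect]
          simp only [finExpect, Finset.mul_sum, Finset.sum_mul]
          rw [Finset.sum_comm]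
          refine Finset.sum_congr rfl fun G _ => Finset.sum_congr rfl fun M' _ => ?_
          ring
      _ = r ^ (j :: l).length * φ M := by
          rw [finExpect_bind_greedyStep, hψ, List.length_cons, pow_succ, mul_assoc]

/-- The law of the output of the greedy algorithm on the random bipartite graph. -/
def greedyLaw (n : ℕ) (p : unitInterval) : PMF (Finset (Fin n × Fin n)) :=
  (randomBipartiteGraph n p).bind greedyMatching

lemma card_freeBins_empty : (freeBins (∅ : Finset (Fin n × Fin n))).card = n := by
  simp [freeBins]

lemma finExpect_greedyLaw (p : unitInterval) (ψ : ℕ → ℝ) (r : ℝ)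
    (hψ : ∀ u : ℕ, (1 - p : ℝ) ^ u * ψ u + (1 - (1 - p : ℝ) ^ u) * ψ (u - 1) = r * ψ u) :
    finExpect (greedyLaw n p) (fun M => ψ (freeBins M).card) = r ^ n * ψ n := by
  have h := finExpect_foldlM_greedyStep p ψ r hψ (List.nodup_finRange n) ∅
  rw [List.length_finRange, card_freeBins_empty] at h
  exact h

lemma freeBins_add_card_of_mem_support_greedyLaw {p : unitInterval} {M : Finset (Fin n × Fin n)}
    (hM : M ∈ (greedyLaw n p).support) : (freeBins M).card + M.card = n := by
  obtain ⟨G, -, hG⟩ := (PMF.mem_support_bind_iff _ _ _).1 hM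
  have := freeBins_add_card_of_mem_support_foldlM hG
  rwa [card_freeBins_empty, Finset.card_empty, add_zero] at this

/-- The variance of `(1 - p) ^ (-u)`, where `u` is the final number of free bins. -/
lemma finExpect_greedyLaw_sq (p : unitInterval) (hp : (p : ℝ) < 1) :
    finExpect (greedyLaw n p)
        (fun M => (((1 - p : ℝ)⁻¹) ^ (freeBins M).card - (2 - (1 - p : ℝ) ^ n)) ^ 2)
      = p / (1 - p) * (1 - (1 - p : ℝ) ^ n) ^ 2 := by
  set q : ℝ := 1 - p with hq
  have hq0 : q ≠ 0 := by rw [hq]; linarith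
  have h₁ := finExpect_greedyLaw (n := n) p (fun u => q⁻¹ ^ u - 1) q (by
    intro u
    cases u with
    | zero => simp
    | succ u =>
      simp only [← hq, inv_pow, Nat.add_sub_cancel]
      field_simp
      ring)
  have h₂ := finExpect_greedyLaw (n := n) p (fun u => (q⁻¹ ^ u - 1) * (q⁻¹ ^ u - q⁻¹)) (q ^ 2) (by
    intro u
    cases u with
    | zero => simp
    | succ u =>
      simp only [← hq, inv_pow, Nat.add_sub_cancel]
      field_simp
      ring)
  have hpq : (p : ℝ) = 1 - q := by rw [hq]; ring
  -- The squared deviation is a combination of the two eigenfunctions and a constant, so its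
  -- expectation is explicit.
  have hexp : ∀ M : Finset (Fin n × Fin n),
      (q⁻¹ ^ (freeBins M).card - (2 - q ^ n)) ^ 2
        = (q⁻¹ ^ (freeBins M).card - 1) * (q⁻¹ ^ (freeBins M).card - q⁻¹)
          + ((q⁻¹ - 1 - 2 * (1 - q ^ n)) * (q⁻¹ ^ (freeBins M).card - 1)
          + (1 - q ^ n) ^ 2) := fun M => by ring
  simp_rw [hexp]
  rw [finExpect_add, finExpect_add, finExpect_const, finExpect_const_mul, h₁, h₂, hpq]
  clear_value q
  simp only [inv_pow]
  field_simp
  ring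

end Greedy

/-! ### Concentration and the limit -/

section Limit

lemma abs_log_sub_log_le {x y : ℝ} (hx : 1 ≤ x) (hy : 1 ≤ y) :
    |Real.log x - Real.log y| ≤ |x - y| := by
  have key : ∀ {x y : ℝ}, 1 ≤ x → 1 ≤ y → Real.log x - Real.log y ≤ |x - y| := by
    intro x y hx hy
    have hx0 : 0 < x := by linarith
    have hy0 : 0 < y := by linarith
    rw [← Real.log_div hx0.ne' hy0.ne']
    calc Real.log (x / y) ≤ x / y - 1 := Real.log_le_sub_one_of_pos (by positivity)
      _ = (x - y) / y := by field_simp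
      _ ≤ |x - y| / y := by gcongr; exact le_abs_self _
      _ ≤ |x - y| := div_le_self (abs_nonneg _) hy
  rw [abs_le]
  exact ⟨by linarith [key hy hx, abs_sub_comm x y], key hx hy⟩

/-- A quantitative concentration bound for the size of the greedy matching, around any value
`1 - a`. -/
lemma greedyMatchingSize_concentration {n : ℕ} (hn : 0 < n) (p : unitInterval)
    (hp0 : 0 < (p : ℝ)) (hp1 : (p : ℝ) < 1) {r a δ : ℝ} (hr : r = -(n * Real.log (1 - p)))
    (hδ : 0 < δ) :
    1 - (p : ℝ) / (1 - p) / δ ^ 2 ≤ ((greedyMatchingSize n p).toMeasure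
      {k : ℕ | |(k : ℝ) / (n : ℝ) - (1 - a)|
        ≤ δ / r + |Real.log (2 - (1 - p : ℝ) ^ n) / r - a|}).toReal := by
  let _ : MeasurableSpace (Finset (Fin n × Fin n)) := ⊤
  have _ : MeasurableSingletonClass (Finset (Fin n × Fin n)) := ⟨fun _ => trivial⟩
  set q : ℝ := 1 - p with hq
  have hq0 : 0 < q := by rw [hq]; linarith
  have hq1 : q < 1 := by rw [hq]; linarith
  have hn' : (0 : ℝ) < n := Nat.cast_pos.2 hn
  have hlog : Real.log q < 0 := Real.log_neg hq0 hq1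
  have hr0 : 0 < r := by
    rw [hr]
    exact neg_pos.2 (mul_neg_of_pos_of_neg hn' hlog)
  have hqn : q ^ n ≤ 1 := pow_le_one₀ hq0.le hq1.le
  set A : Set (Finset (Fin n × Fin n)) :=
    {M | δ < |q⁻¹ ^ (freeBins M).card - (2 - q ^ n)|} with hA
  have hcheb : ((greedyLaw n p).toMeasure A).toReal ≤ (p : ℝ) / q / δ ^ 2 := by
    refine (toMeasure_toReal_le_of_finExpect_sq (greedyLaw n p)
      (fun M => q⁻¹ ^ (freeBins M).card) (2 - q ^ n) hδ).trans ?_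
    rw [finExpect_greedyLaw_sq p hp1, ← hq]
    gcongr
    have hqn0 : 0 < q ^ n := pow_pos hq0 n
    exact mul_le_of_le_one_right (by positivity)
      (pow_le_one₀ (by linarith) (by linarith))
  have hcompl : 1 - ((greedyLaw n p).toMeasure A).toReal
      = ((greedyLaw n p).toMeasure Aᶜ).toReal :=
    (MeasureTheory.probReal_compl_eq_one_sub (μ := (greedyLaw n p).toMeasure) trivial).symm
  refine (sub_le_sub_left hcheb 1).trans ?_
  rw [hcompl]
  refine ENNReal.toReal_mono (MeasureTheory.measure_ne_top _ _) ?_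
  rw [show greedyMatchingSize n p = (greedyLaw n p).map Finset.card from rfl,
    PMF.toMeasure_map_apply _ _ _ (measurable_from_top) (MeasurableSet.of_discrete)]
  refine PMF.toMeasure_mono _ trivial ?_
  rintro M ⟨hMA, hM⟩
  have hcard : ((freeBins M).card : ℝ) + (M.card : ℝ) = n := by
    exact_mod_cast freeBins_add_card_of_mem_support_greedyLaw hM
  have hMA' : |q⁻¹ ^ (freeBins M).card - (2 - q ^ n)| ≤ δ := not_lt.1 hMA
  -- Both q^(-u) and 2 - q^n are at least 1, where log is 1-Lipschitz.
  have hle := (abs_log_sub_log_le (one_le_pow₀ (one_le_inv_iff₀.2 ⟨hq0, hq1.le⟩)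
    (n := (freeBins M).card)) (by linarith : 1 ≤ 2 - q ^ n)).trans hMA'
  have hfrac : ((freeBins M).card : ℝ) / n = Real.log (q⁻¹ ^ (freeBins M).card) / r := by
    have hlog_ne := hlog.ne
    rw [hr, Real.log_pow, Real.log_inv]
    field_simp
  have hsplit : (M.card : ℝ) / n - (1 - a)
      = -((Real.log (q⁻¹ ^ (freeBins M).card) - Real.log (2 - q ^ n)) / r
        + (Real.log (2 - q ^ n) / r - a)) := by
    rw [sub_div, ← hfrac, show (M.card : ℝ) = n - (freeBins M).card by linarith, sub_div,
      div_self hn'.ne']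
    ring
  change |(M.card : ℝ) / n - (1 - a)| ≤ _
  rw [hsplit, abs_neg]
  refine (abs_add_le _ _).trans ?_
  rw [abs_div, abs_of_pos hr0]
  gcongr

end Limit

end

theorem theorem3 (c : ℝ) (hc : 0 < c) (p : ℕ → unitInterval)
    (hp : ∀ᶠ n : ℕ in atTop, (p n : ℝ) = c / (n : ℝ)) :
    ∃ ε : ℕ → ℝ, Tendsto ε atTop (𝓝 0) ∧
      Tendsto (fun n : ℕ => (greedyMatchingSize n (p n)).toMeasure
          {k : ℕ | |(k : ℝ) / (n : ℝ) - (1 - Real.log (2 - Real.exp (-c)) / c)| ≤ ε n})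
        atTop (𝓝 1) := by
  set x : ℕ → ℝ := fun n => (p n : ℝ) / (1 - p n) with hx
  set r : ℕ → ℝ := fun n => -(n * Real.log (1 - p n)) with hr
  -- The fourth root makes both the error `δ` and the Chebyshev bound x/δ² = √x tend to 0.
  set δ : ℕ → ℝ := fun n => √√(x n) with hδ
  have hnp : Tendsto (fun n : ℕ => (n : ℝ) * -(p n : ℝ)) atTop (𝓝 (-c)) := by
    refine tendsto_const_nhds.congr' ?_
    filter_upwards [hp, eventually_gt_atTop 0] with n hn hn0
    have : (n : ℝ) ≠ 0 := Nat.cast_ne_zero.2 hn0.ne'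
    rw [hn]
    field_simp
  have hp0 : Tendsto (fun n => (p n : ℝ)) atTop (𝓝 0) :=
    (tendsto_const_div_atTop_nhds_zero_nat c).congr' (hp.mono fun n hn => hn.symm)
  have hx0 : Tendsto x atTop (𝓝 0) := by
    have := hp0.div (tendsto_const_nhds.sub hp0 : Tendsto (fun n => 1 - (p n : ℝ)) atTop _)
      (by norm_num)
    simpa [Pi.div_def] using this
  have hrc : Tendsto r atTop (𝓝 c) := by
    simpa [hr, sub_eq_add_neg] using (Real.tendsto_nat_mul_log_one_add_of_tendsto hnp).neg
  have hqn : Tendsto (fun n => (1 - p n : ℝ) ^ n) atTop (𝓝 (Real.exp (-c))) := by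
    simpa [sub_eq_add_neg] using Real.tendsto_one_add_pow_exp_of_tendsto hnp
  have hδ0 : Tendsto δ atTop (𝓝 0) := by
    simpa using hx0.sqrt.sqrt
  have hexp : Real.exp (-c) < 1 := Real.exp_lt_one_iff.2 (by linarith)
  have hlim : Tendsto (fun n => Real.log (2 - (1 - p n : ℝ) ^ n) / r n) atTop
      (𝓝 (Real.log (2 - Real.exp (-c)) / c)) :=
    ((tendsto_const_nhds.sub hqn).log (by linarith)).div hrc hc.ne'
  refine ⟨fun n => δ n / r n
    + |Real.log (2 - (1 - p n : ℝ) ^ n) / r n - Real.log (2 - Real.exp (-c)) / c|, ?_, ?_⟩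
  · simpa using (hδ0.div hrc hc.ne').add (hlim.sub_const (Real.log (2 - Real.exp (-c)) / c)).abs
  · rw [← ENNReal.tendsto_toReal_iff (fun n => MeasureTheory.measure_ne_top _ _) ENNReal.one_ne_top,
      ENNReal.toReal_one]
    have hlow : Tendsto (fun n => 1 - √(x n)) atTop (𝓝 1) := by
      simpa using hx0.sqrt.const_sub 1
    refine tendsto_of_tendsto_of_tendsto_of_le_of_le' hlow tendsto_const_nhds ?_
      (.of_forall fun n => MeasureTheory.measureReal_le_one)
    filter_upwards [hp, eventually_gt_atTop 0, hp0.eventually_lt_const one_pos] with n hn hn0 hn1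
    have hppos : 0 < (p n : ℝ) := by
      rw [hn]
      have : (0 : ℝ) < n := Nat.cast_pos.2 hn0
      positivity
    have hxpos : 0 < x n := div_pos hppos (by linarith)
    have hδpos : 0 < δ n := Real.sqrt_pos.2 (Real.sqrt_pos.2 hxpos)
    refine le_trans (le_of_eq ?_) (greedyMatchingSize_concentration hn0 (p n) hppos hn1 rfl hδpos)
    change 1 - √(x n) = 1 - x n / δ n ^ 2
    rw [hδ, Real.sq_sqrt (Real.sqrt_nonneg _), Real.div_sqrt]
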